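/- A cyclotomic integer is an element of the subring of $\mathbb{C}$ generated by all roots of unity. For an algebraic integer $\alpha$, the house $\operatorname{house}(\alpha)$ is the maximum of $|\beta|$ as $\beta$ ranges over the conjugates of $\alpha$ over $\mathbb{Q}$ in $\mathbb{C}$. Two algebraic integers $\alpha,\beta$ are equivalent if $\beta$ equals a root of unity times a conjugate of $\alpha$. Write $\zeta_n = e^{2\pi i/n}$. Consider the following table of 33 entries $\alpha$; in each entry, $\zeta$ denotes an (arbitrary) root of unity of exact order $N$, chosen separately for each entry. | | $N$ | $\alpha$ | |---|---|---| | 1 | 11 | $1+\zeta+\zeta^2+\zeta^4-\zeta^5+\zeta^7$ | | 2 | 19 | $1+\zeta+\zeta^4+\zeta^7+\zeta^8+\zeta^9+\zeta^{10}+\zeta^{12}+\zeta^{14}$ | | 3 | 20 | $1+\zeta+\zeta^3-\zeta^4$ | | 4 | 24 | $1+\zeta+\zeta^5-\zeta^6$ | | 5 | 31 | $1+\zeta+\zeta^3+\zeta^8+\zeta^{12}+\zeta^{18}$ | | 6 | 51 | $1+\zeta^3-\zeta^{10}+\zeta^{15}+\zeta^{21}+\zeta^{24}+\zeta^{30}+\zeta^{33}+\zeta^{39}$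 | | 7 | 84 | $1-\zeta^4-\zeta^{13}-\zeta^{16}+\zeta^{19}+\zeta^{21}+\zeta^{22}+\zeta^{31}$ | | 8 | 91 | $1+\zeta^7+\zeta^{14}-\zeta^{17}+\zeta^{21}+\zeta^{42}-\zeta^{69}+\zeta^{70}-\zeta^{82}$ | | 9 | 33 | $1+\zeta^6-\zeta^8+\zeta^{21}$ | | 10 | 28 | $1+\zeta-\zeta^3-\zeta^{11}$ | | 11 | 33 | $1+\zeta^6-\zeta^7-\zeta^{10}$ | | 12 | 21 | $1-\zeta-\zeta^5+\zeta^{18}$ | | 13 | 28 | $1+\zeta-\zeta^3+\zeta^4$ | | 14 | 21 | $1-\zeta+\zeta^6+\zeta^{18}$ | | 15 | 60 | $1-\zeta^3-\zeta^6-\zeta^8$ | | 16 | 11 | $1+\zeta+\zeta^2+\zeta^5$ | | 17 | 35 | $1-\zeta^6+\zeta^7+\zeta^{10}+\zeta^{15}+\zeta^{17}+\zeta^{22}$ | | 18 | 40 | $1-\zeta^3+\zeta^7+\zeta^{10}$ | | 19 | 60 | $1-\zeta^3-\zeta^5-\zeta^8$ | | 20 | 24 | $1+\zeta+\zeta^7$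 | | 21 | 13 | $1+\zeta+\zeta^4$ | | 22 | 21 | $1-\zeta-\zeta^4+\zeta^{12}$ | | 23 | 7 | $\zeta+\zeta^3+\zeta^4-\zeta^5 \;(=(1+\zeta+\zeta^3)^2)$ | | 24 | 28 | $(1+i)(1+\zeta_7+\zeta_7^3)$ | | 25 | 39 | $1-\zeta^2-\zeta^5-\zeta^8-\zeta^{11}-\zeta^{20}-\zeta^{32}$ | | 26 | 55 | $1-\zeta-\zeta^{16}+\zeta^{22}-\zeta^{26}-\zeta^{31}-\zeta^{36}$ | | 27 | 60 | $(1+i)(1-\zeta_{15}+\zeta_{15}^{12})$ | | 28 | 105 | $(1+\zeta_7+\zeta_7^3)(1-\zeta_{15}+\zeta_{15}^{12})$ | | 29 | 21 | $1-\zeta-\zeta^{13}$ | | 30 | 11 | $1+\zeta+\zeta^2+\zeta^4+\zeta^7$ | | 31 | 13 | $1+\zeta+\zeta^3+\zeta^9$ | | 32 | 35 | $1-\zeta+\zeta^7-\zeta^{11}-\zeta^{16}$ | | 33 | 7 | $1+\zeta+\zeta^3$ | Then each entry $\alpha$ of the table is a cyclotomic integer with $\operatorname{house}(\alpha)^2 \le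 5$, and $\alpha$ is of none of the following forms: 1. $\alpha$ is a sum of at most two roots of unity; 2. $\alpha$ is equivalent to $1+\eta-\eta^{-1}$ for some root of unity $\eta$; 3. $\alpha$ is equivalent to $(\zeta_5+\zeta_5^4)+(\zeta_5^2+\zeta_5^3)\eta$ for some root of unity $\eta$. Moreover, no two distinct entries of the table are equivalent. -/

import Mathlib

namespace CyclotomicHouse

noncomputable section

/-- The ring of cyclotomic integers: the subring of `ℂ` generated by all roots of unity.
For `z : ℂ`, `IsOfFinOrder z` says that `z ^ n = 1` for some `n ≥ 1`. -/
def cyclotomicIntegers : Subring ℂ :=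
  Subring.closure {z : ℂ | IsOfFinOrder z}

/-- The house of an algebraic number `α`: the maximum of `|β|` over the conjugates `β` of `α`
in `ℂ` (the complex numbers with the same minimal polynomial over `ℚ`). The supremum is attained
for algebraic `α`, see `isGreatest_house`. -/
def house (α : ℂ) : ℝ :=
  sSup {r : ℝ | ∃ β : ℂ, IsConjRoot ℚ α β ∧ r = ‖β‖}

theorem isGreatest_house {α : ℂ} (hα : IsAlgebraic ℚ α) :
    IsGreatest {r : ℝ | ∃ β : ℂ, IsConjRoot ℚ α β ∧ r = ‖β‖} (house α) := by
  have hfin : {r : ℝ | ∃ β : ℂ, IsConjRoot ℚ α β ∧ r = ‖β‖}.Finite := by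
    refine (((minpoly ℚ α).rootSet_finite ℂ).image (fun z : ℂ => ‖z‖)).subset ?_
    rintro r ⟨β, hβ, rfl⟩
    refine ⟨β, ?_, rfl⟩
    rw [Polynomial.mem_rootSet]
    exact ⟨minpoly.ne_zero hα.isIntegral, hβ.aeval_eq_zero⟩
  have hne : {r : ℝ | ∃ β : ℂ, IsConjRoot ℚ α β ∧ r = ‖β‖}.Nonempty :=
    ⟨‖α‖, α, IsConjRoot.refl, rfl⟩
  exact ⟨hne.csSup_mem hfin, fun r hr => le_csSup hfin.bddAbove hr⟩

/-- Two algebraic integers `α`, `β` are equivalent if `β` is a root of unity times a conjugate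
of `α` over `ℚ`. -/
def Equivalent (α β : ℂ) : Prop :=
  ∃ ρ α' : ℂ, IsOfFinOrder ρ ∧ IsConjRoot ℚ α α' ∧ β = ρ * α'

/-- The root of unity `ζ_n = exp (2πi/n)`. -/
def zeta (n : ℕ) : ℂ := Complex.exp (2 * Real.pi * Complex.I / n)

/-- First form: `α` is a sum of at most two roots of unity (the empty sum being `0`). -/
def IsFormOne (α : ℂ) : Prop :=
  ∃ s : Multiset ℂ, s.card ≤ 2 ∧ (∀ z ∈ s, IsOfFinOrder z) ∧ s.sum = α

/-- Second form: `α` is equivalent to `1 + ζ - ζ⁻¹` for some root of unity `ζ`. -/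
def IsFormTwo (α : ℂ) : Prop :=
  ∃ ζ : ℂ, IsOfFinOrder ζ ∧ Equivalent α (1 + ζ - ζ⁻¹)

/-- Third form: `α` is equivalent to `(ζ₅ + ζ₅⁴) + (ζ₅² + ζ₅³) ζ` for some root of unity `ζ`. -/
def IsFormThree (α : ℂ) : Prop :=
  ∃ ζ : ℂ, IsOfFinOrder ζ ∧
    Equivalent α ((zeta 5 + zeta 5 ^ 4) + (zeta 5 ^ 2 + zeta 5 ^ 3) * ζ)

/-- An entry of the table: the listed level `N`, and the expression for `α` in terms of a root of
unity `ζ` of order `N`. -/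
structure TableEntry where
  level : ℕ
  value : ℂ → ℂ

/-- The table of the 33 exceptional values, in the order of the rows. -/
def exceptionalTable : Fin 33 → TableEntry := ![
  -- castle 5
  ⟨11, fun ζ => 1 + ζ + ζ ^ 2 + ζ ^ 4 - ζ ^ 5 + ζ ^ 7⟩,
  ⟨19, fun ζ => 1 + ζ + ζ ^ 4 + ζ ^ 7 + ζ ^ 8 + ζ ^ 9 + ζ ^ 10 + ζ ^ 12 + ζ ^ 14⟩,
  ⟨20, fun ζ => 1 + ζ + ζ ^ 3 - ζ ^ 4⟩,
  ⟨24, fun ζ => 1 + ζ + ζ ^ 5 - ζ ^ 6⟩,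
  ⟨31, fun ζ => 1 + ζ + ζ ^ 3 + ζ ^ 8 + ζ ^ 12 + ζ ^ 18⟩,
  ⟨51, fun ζ => 1 + ζ ^ 3 - ζ ^ 10 + ζ ^ 15 + ζ ^ 21 + ζ ^ 24 + ζ ^ 30 + ζ ^ 33 + ζ ^ 39⟩,
  ⟨84, fun ζ => 1 - ζ ^ 4 - ζ ^ 13 - ζ ^ 16 + ζ ^ 19 + ζ ^ 21 + ζ ^ 22 + ζ ^ 31⟩,
  ⟨91, fun ζ => 1 + ζ ^ 7 + ζ ^ 14 - ζ ^ 17 + ζ ^ 21 + ζ ^ 42 - ζ ^ 69 + ζ ^ 70 - ζ ^ 82⟩,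
  -- castle strictly between 4 and 5
  ⟨33, fun ζ => 1 + ζ ^ 6 - ζ ^ 8 + ζ ^ 21⟩,
  ⟨28, fun ζ => 1 + ζ - ζ ^ 3 - ζ ^ 11⟩,
  ⟨33, fun ζ => 1 + ζ ^ 6 - ζ ^ 7 - ζ ^ 10⟩,
  ⟨21, fun ζ => 1 - ζ - ζ ^ 5 + ζ ^ 18⟩,
  ⟨28, fun ζ => 1 + ζ - ζ ^ 3 + ζ ^ 4⟩,
  ⟨21, fun ζ => 1 - ζ + ζ ^ 6 + ζ ^ 18⟩,
  ⟨60, fun ζ => 1 - ζ ^ 3 - ζ ^ 6 - ζ ^ 8⟩,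
  ⟨11, fun ζ => 1 + ζ + ζ ^ 2 + ζ ^ 5⟩,
  ⟨35, fun ζ => 1 - ζ ^ 6 + ζ ^ 7 + ζ ^ 10 + ζ ^ 15 + ζ ^ 17 + ζ ^ 22⟩,
  ⟨40, fun ζ => 1 - ζ ^ 3 + ζ ^ 7 + ζ ^ 10⟩,
  ⟨60, fun ζ => 1 - ζ ^ 3 - ζ ^ 5 - ζ ^ 8⟩,
  ⟨24, fun ζ => 1 + ζ + ζ ^ 7⟩,
  ⟨13, fun ζ => 1 + ζ + ζ ^ 4⟩,
  ⟨21, fun ζ => 1 - ζ - ζ ^ 4 + ζ ^ 12⟩,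
  -- castle 4; the first value is also `(1 + ζ + ζ ^ 3) ^ 2`, see `square_eq` below
  ⟨7, fun ζ => ζ + ζ ^ 3 + ζ ^ 4 - ζ ^ 5⟩,
  ⟨28, fun _ => (1 + Complex.I) * (1 + zeta 7 + zeta 7 ^ 3)⟩,
  ⟨39, fun ζ => 1 - ζ ^ 2 - ζ ^ 5 - ζ ^ 8 - ζ ^ 11 - ζ ^ 20 - ζ ^ 32⟩,
  ⟨55, fun ζ => 1 - ζ - ζ ^ 16 + ζ ^ 22 - ζ ^ 26 - ζ ^ 31 - ζ ^ 36⟩,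
  ⟨60, fun _ => (1 + Complex.I) * (1 - zeta 15 + zeta 15 ^ 12)⟩,
  ⟨105, fun _ => (1 + zeta 7 + zeta 7 ^ 3) * (1 - zeta 15 + zeta 15 ^ 12)⟩,
  -- castle less than 4
  ⟨21, fun ζ => 1 - ζ - ζ ^ 13⟩,
  ⟨11, fun ζ => 1 + ζ + ζ ^ 2 + ζ ^ 4 + ζ ^ 7⟩,
  ⟨13, fun ζ => 1 + ζ + ζ ^ 3 + ζ ^ 9⟩,
  ⟨35, fun ζ => 1 - ζ + ζ ^ 7 - ζ ^ 11 - ζ ^ 16⟩,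
  ⟨7, fun ζ => 1 + ζ + ζ ^ 3⟩]

theorem square_eq {ζ : ℂ} (hζ : IsPrimitiveRoot ζ 7) :
    (1 + ζ + ζ ^ 3) ^ 2 = ζ + ζ ^ 3 + ζ ^ 4 - ζ ^ 5 := by
  have h := hζ.geom_sum_eq_zero (by norm_num)
  simp only [Finset.sum_range_succ, Finset.sum_range_zero] at h
  linear_combination h

end

end CyclotomicHouse

/-! House. The minimal polynomial of `αᾱ - 5` has nonnegative coefficients, so it has no positive
root and every conjugate satisfies `|β|² ≤ 5`. The polynomial relation is checked exactly in
`ℤ[X]/(X^N - 1)` (`norm_sq_le_five`).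

Excluded forms. Let `ω` be a root of unity of order `M = commonLevel`, so that all rows lie in
`ℚ(ω)`. If a row had one of the forms, some `x = ρα`, with `ρ` a root of unity and `α` a conjugate
of the row, would be `1 + η`, `1 + η - η⁻¹` or the third expression. In each case `x + x̄` is a
polynomial in `ω` (for the first and third forms, through `αᾱ`), so `x` is a root of `X² - (x + x̄)X
+ αᾱ` over `ℚ(ω)`. Thus `ρ` has degree at most 2 over `ℚ(ω)`, which forces `ρ ^ (12 * M) = 1`
(`pow_eq_one_of_quadratic`). The unknown `η` has been eliminated, and `ρ` disappears on taking `12 *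
M`-th powers.

All relations now live in `ℤ[ξ]` with `ξ` of order `12 * M`, and they survive reduction modulo a
prime `p ≡ 1 mod 12 * M`. In `𝔽_p` the reduced quadratic would have a root whose `12 * M`-th power
equals that of the reduced row; a norm computation refutes this (`quadNorm_eq_zero`).

Inequivalence. Equivalent rows would, after conjugation, have equal `12 * M`-th powers modulo `p`;
all conjugates are compared (`invariants_ne`). -/

namespace CyclotomicHouse

open Polynomial IntermediateField

/-! ### Sparse polynomials in roots of unity and their conjugates -/

/-- The value at `x` of the sparse polynomial with the given (coefficient, exponent) pairs. -/
def evalTerms {R : Type*} [CommRing R] (l : List (ℤ × ℕ)) (x : R) : R :=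
  (l.map fun t => (t.1 : R) * x ^ t.2).sum

section evalTerms

variable {R S : Type*} [CommRing R] [CommRing S]

@[simp] theorem evalTerms_nil (x : R) : evalTerms [] x = 0 := rfl

@[simp] theorem evalTerms_cons (t : ℤ × ℕ) (l : List (ℤ × ℕ)) (x : R) :
    evalTerms (t :: l) x = t.1 * x ^ t.2 + evalTerms l x := by
  simp [evalTerms]

theorem map_evalTerms (f : R →+* S) (l : List (ℤ × ℕ)) (x : R) :
    f (evalTerms l x) = evalTerms l (f x) := by
  induction l with
  | nil => simp
  | cons t l ih => simp [ih]

end evalTerms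

theorem evalTerms_mem_cyclotomicIntegers (l : List (ℤ × ℕ)) {ζ : ℂ} (hζ : IsOfFinOrder ζ) :
    evalTerms l ζ ∈ cyclotomicIntegers := by
  induction l with
  | nil => simp
  | cons t l ih =>
    rw [evalTerms_cons]
    exact add_mem (mul_mem (intCast_mem _ _)
      (pow_mem (Subring.subset_closure (show ζ ∈ {z : ℂ | IsOfFinOrder z} from hζ)) _)) ih

theorem evalTerms_mem_intermediateField (l : List (ℤ × ℕ)) {F : IntermediateField ℚ ℂ} {ζ : ℂ}
    (hζ : ζ ∈ F) : evalTerms l ζ ∈ F := by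
  induction l with
  | nil => simp
  | cons t l ih =>
    rw [evalTerms_cons]
    exact add_mem (mul_mem (intCast_mem _ _) (pow_mem hζ _)) ih

theorem isIntegral_of_isPrimitiveRoot {N : ℕ} (hN : 0 < N) {ζ : ℂ} (hζ : IsPrimitiveRoot ζ N) :
    IsIntegral ℚ ζ :=
  (hζ.isIntegral hN).tower_top

theorem isAlgebraic_evalTerms {N : ℕ} (hN : 0 < N) {ζ : ℂ} (hζ : IsPrimitiveRoot ζ N)
    (l : List (ℤ × ℕ)) : IsAlgebraic ℚ (evalTerms l ζ) := by
  have hi := isIntegral_of_isPrimitiveRoot hN hζ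
  have : Algebra.IsAlgebraic ℚ ℚ⟮ζ⟯ := isAlgebraic_adjoin_simple hi
  have hm := evalTerms_mem_intermediateField l (mem_adjoin_simple_self ℚ ζ)
  exact (Algebra.IsAlgebraic.isAlgebraic (R := ℚ) (⟨_, hm⟩ : ℚ⟮ζ⟯)).algebraMap (A := ℂ)

/-- The conjugates of a polynomial expression in a primitive root of unity. -/
theorem exists_isPrimitiveRoot_of_isConjRoot {N : ℕ} (hN : 0 < N) {ζ : ℂ}
    (hζ : IsPrimitiveRoot ζ N) (l : List (ℤ × ℕ)) {β : ℂ}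
    (h : IsConjRoot ℚ (evalTerms l ζ) β) :
    ∃ ζ' : ℂ, IsPrimitiveRoot ζ' N ∧ β = evalTerms l ζ' := by
  have hi := isIntegral_of_isPrimitiveRoot hN hζ
  have hm := evalTerms_mem_intermediateField l (mem_adjoin_simple_self ℚ ζ)
  -- As `β` is a root of the minimal polynomial of the value, some embedding of `ℚ(ζ)` in `ℂ` sends
  -- the value to `β`.
  obtain ⟨φ, hφ⟩ := IntermediateField.exists_algHom_adjoin_of_splits_of_aeval (F := ℚ) (K := ℂ)
    (S := {ζ}) (x := evalTerms l ζ) (y := β)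
    (by
      rintro s rfl
      exact ⟨hi, IsAlgClosed.splits _⟩) hm h.aeval_eq_zero
  have hg : IsPrimitiveRoot (AdjoinSimple.gen ℚ ζ) N :=
    IsPrimitiveRoot.of_map_of_injective (f := algebraMap ℚ⟮ζ⟯ ℂ) (by simpa using hζ)
      (algebraMap ℚ⟮ζ⟯ ℂ).injective
  refine ⟨φ (AdjoinSimple.gen ℚ ζ), hg.map_of_injective φ.injective, ?_⟩
  have h1 : (⟨evalTerms l ζ, hm⟩ : ℚ⟮ζ⟯) = evalTerms l (AdjoinSimple.gen ℚ ζ) := by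
    apply (algebraMap ℚ⟮ζ⟯ ℂ).injective
    rw [map_evalTerms]
    rfl
  rw [← hφ]
  exact (congrArg φ h1).trans (map_evalTerms φ.toRingHom l _)

theorem conj_evalTerms (l : List (ℤ × ℕ)) {ζ : ℂ} (hζ : ‖ζ‖ = 1) :
    starRingEnd ℂ (evalTerms l ζ) = evalTerms l ζ⁻¹ := by
  rw [map_evalTerms, Complex.inv_eq_conj hζ]

/-! ### Roots of unity of degree at most two over a cyclotomic field -/

/-- For a prime power `p ^ e` dividing `k`, `φ(p ^ e) = p ^ (e - 1) * (p - 1)` divides `φ(k)`, which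
leaves only 2, 3 and 4. -/
theorem dvd_twelve_of_totient_le_two {k : ℕ} (hk : k.totient ≤ 2) (h0 : 0 < k) : k ∣ 12 := by
  rw [Nat.dvd_iff_prime_pow_dvd_dvd]
  intro p e hp hpe
  rcases Nat.eq_zero_or_pos e with rfl | he
  · simp
  have h1 := Nat.le_of_dvd (Nat.totient_pos.2 h0) (Nat.totient_dvd_of_dvd hpe)
  rw [Nat.totient_prime_pow hp he] at h1
  obtain ⟨e, rfl⟩ : ∃ d, e = d + 1 := ⟨e - 1, by omega⟩
  have h2 : p ^ e * (p - 1) ≤ 2 := h1.trans hk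
  have hp2 := hp.two_le
  have h3 : p - 1 ≤ 2 := le_trans (Nat.le_mul_of_pos_left _ (by positivity)) h2
  have h4 : p ^ e ≤ 2 := le_trans (Nat.le_mul_of_pos_right _ (by omega)) h2
  have h5 : e ≤ 1 := by
    by_contra! h
    have := Nat.pow_le_pow_right hp.pos h
    nlinarith
  have h6 : p ≤ 3 := by omega
  interval_cases e <;> interval_cases p <;> revert h4 h2 <;> decide

/-- A root of unity of degree at most two over the `M`-th cyclotomic field has order dividing
`12 * M`. -/
theorem pow_eq_one_of_quadratic {M : ℕ} (hM : 0 < M) {ζ ρ : ℂ} (hζ : IsPrimitiveRoot ζ M)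
    (hρ : IsOfFinOrder ρ) {a b c : ℂ} (ha : a ∈ ℚ⟮ζ⟯) (hb : b ∈ ℚ⟮ζ⟯) (hc : c ∈ ℚ⟮ζ⟯)
    (ha0 : a ≠ 0) (h : a * ρ ^ 2 + b * ρ + c = 0) : ρ ^ (12 * M) = 1 := by
  have hn : 0 < orderOf ρ := hρ.orderOf_pos
  set n := orderOf ρ with hn'
  have hρn : IsPrimitiveRoot ρ n := IsPrimitiveRoot.orderOf ρ
  have hlcm : 0 < M.lcm n := Nat.lcm_pos hM hn
  obtain ⟨k, hk⟩ := Nat.dvd_lcm_left M n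
  have hk0 : 0 < k := by
    rw [hk] at hlcm
    exact Nat.pos_of_mul_pos_left hlcm
  -- This product has order `lcm(M, n) = M * k` and lies in `ℚ(ζ, ρ)`, of degree at most `2 * φ(M)`.
  have hξ := hζ.pow_mul_pow_lcm hρn hM.ne' hn.ne'
  set ξ := ζ ^ (M / Nat.factorizationLCMLeft M n) * ρ ^ (n / Nat.factorizationLCMRight M n)
  have hint : IsIntegral ℚ⟮ζ⟯ ρ := (isIntegral_of_isPrimitiveRoot hn hρn).tower_top
  have hdeg : Module.finrank ℚ⟮ζ⟯ ℚ⟮ζ⟯⟮ρ⟯ ≤ 2 := by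
    rw [adjoin.finrank hint]
    let P : (ℚ⟮ζ⟯)[X] := C ⟨a, ha⟩ * X ^ 2 + C ⟨b, hb⟩ * X + C ⟨c, hc⟩
    have ha' : (⟨a, ha⟩ : ℚ⟮ζ⟯) ≠ 0 := fun h => ha0 (congrArg Subtype.val h)
    have hP : P.natDegree = 2 := natDegree_quadratic ha'
    have hP0 : P ≠ 0 := by
      intro h
      rw [h] at hP
      simp at hP
    rw [← hP]
    apply natDegree_le_of_dvd _ hP0
    apply minpoly.dvd
    simp only [P, map_add, map_mul, aeval_C, aeval_X, map_pow]
    exact h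
  have : FiniteDimensional ℚ ℚ⟮ζ⟯ := adjoin.finiteDimensional (isIntegral_of_isPrimitiveRoot hM hζ)
  have : FiniteDimensional ℚ⟮ζ⟯ ℚ⟮ζ⟯⟮ρ⟯ := adjoin.finiteDimensional hint
  have hfr : ∀ {m : ℕ} {x : ℂ}, 0 < m → IsPrimitiveRoot x m →
      Module.finrank ℚ ℚ⟮x⟯ = m.totient := by
    intro m x hm hx
    rw [adjoin.finrank (isIntegral_of_isPrimitiveRoot hm hx), ← cyclotomic_eq_minpoly_rat hx hm,
      natDegree_cyclotomic]
  have hle : Module.finrank ℚ ℚ⟮ξ⟯ ≤ Module.finrank ℚ ℚ⟮ζ⟯⟮ρ⟯ := by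
    have : FiniteDimensional ℚ ℚ⟮ζ⟯⟮ρ⟯ := FiniteDimensional.trans ℚ ℚ⟮ζ⟯ _
    have hsub : ℚ⟮ξ⟯ ≤ (ℚ⟮ζ⟯⟮ρ⟯).restrictScalars ℚ := by
      rw [adjoin_simple_le_iff]
      exact mul_mem (pow_mem ((ℚ⟮ζ⟯⟮ρ⟯).algebraMap_mem ⟨ζ, mem_adjoin_simple_self ℚ ζ⟩) _)
        (pow_mem (mem_adjoin_simple_self _ ρ) _)
    exact LinearMap.finrank_le_finrank_of_injective
      (f := (IntermediateField.inclusion hsub).toLinearMap) (IntermediateField.inclusion hsub).injective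
  rw [← Module.finrank_mul_finrank ℚ ℚ⟮ζ⟯ ℚ⟮ζ⟯⟮ρ⟯, hfr hlcm hξ, hfr hM hζ, hk] at hle
  -- `φ(M) * φ(k) ≤ φ(M * k) ≤ 2 * φ(M)`, hence `φ(k) ≤ 2`.
  have h1 := (Nat.totient_super_multiplicative M k).trans (hle.trans (Nat.mul_le_mul_left _ hdeg))
  have h2 := Nat.le_of_mul_le_mul_left h1 (Nat.totient_pos.2 hM)
  have h3 := dvd_twelve_of_totient_le_two h2 hk0
  have h4 : n ∣ 12 * M := by
    refine (Nat.dvd_lcm_right M n).trans ?_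
    rw [hk, mul_comm]
    exact Nat.mul_dvd_mul_right h3 M
  exact (hρn.pow_eq_one_iff_dvd _).2 h4

/-! ### Transfer of relations and lifting of roots of unity -/

/-- Integral polynomial relations satisfied by a primitive `L`-th root of unity in `ℂ` hold for
primitive `L`-th roots of unity in every domain. -/
theorem aeval_eq_zero_of_isPrimitiveRoot {K : Type*} [CommRing K] [IsDomain K] {L : ℕ}
    (hL : 0 < L) {ζ : ℂ} (hζ : IsPrimitiveRoot ζ L) {z : K} (hz : IsPrimitiveRoot z L)
    {P : ℤ[X]} (h : aeval ζ P = 0) : aeval z P = 0 := by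
  have hd : cyclotomic L ℤ ∣ P := by
    rw [cyclotomic_eq_minpoly hζ hL]
    exact minpoly.isIntegrallyClosed_dvd (hζ.isIntegral hL) h
  obtain ⟨Q, rfl⟩ := hd
  have : aeval z (cyclotomic L ℤ) = 0 := by
    rw [aeval_def, eval₂_eq_eval_map, map_cyclotomic]
    exact hz.isRoot_cyclotomic hL
  rw [map_mul, this, zero_mul]

/-- A primitive root of unity of order `N` is a power of one of order `N * E`. -/
theorem exists_isPrimitiveRoot_pow_eq {N E : ℕ} (h0 : 0 < N * E) {ζ : ℂ}
    (hζ : IsPrimitiveRoot ζ N) : ∃ ξ : ℂ, IsPrimitiveRoot ξ (N * E) ∧ ξ ^ E = ζ := by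
  have : NeZero (N * E) := ⟨h0.ne'⟩
  have hN : 0 < N := Nat.pos_of_mul_pos_right h0
  have : NeZero N := ⟨hN.ne'⟩
  have hξ := Complex.isPrimitiveRoot_exp (N * E) h0.ne'
  set ξ := Complex.exp (2 * Real.pi * Complex.I / (N * E : ℕ))
  have hp : IsPrimitiveRoot (ξ ^ E) N := hξ.pow h0 (mul_comm _ _)
  obtain ⟨k, hk, hc, hkz⟩ := hp.isPrimitiveRoot_iff.1 hζ
  -- `k` is coprime to `N` but perhaps not to `E`; it is replaced by an exponent congruent to it
  -- modulo `N` and coprime to `N * E`.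
  obtain ⟨u, hu⟩ := ZMod.unitsMap_surjective (Nat.dvd_mul_right N E) (ZMod.unitOfCoprime k hc)
  refine ⟨ξ ^ (u : ZMod (N * E)).val, hξ.pow_of_coprime _ (ZMod.val_coe_unit_coprime u), ?_⟩
  have hmod : (u : ZMod (N * E)).val ≡ k [MOD N] := by
    rw [← ZMod.natCast_eq_natCast_iff]
    have h2 := congrArg Units.val hu
    rw [ZMod.unitsMap_val, ZMod.coe_unitOfCoprime] at h2
    rw [← h2, ZMod.natCast_val]
  rw [← hkz, ← pow_mul, mul_comm, pow_mul]
  rw [pow_eq_pow_mod _ hp.pow_eq_one, pow_eq_pow_mod k hp.pow_eq_one, hmod]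

/-! ### The prime modulus and its roots of unity -/

/-- A prime congruent to `1` modulo `12` times the least common multiple of the levels. -/
def modulus : ℕ := 19874432017441

/-- The least common multiple of the levels of the table. -/
def commonLevel : ℕ := 1202761560

/-- `x ^ n % modulus` by repeated squaring, with `fuel` steps. -/
def powMod (x : ℕ) : ℕ → ℕ → ℕ
  | 0, n => x ^ n % modulus
  | fuel + 1, n => powMod x fuel (n / 2) ^ 2 * x ^ (n % 2) % modulus

theorem cast_mod_modulus (n : ℕ) : ((n % modulus : ℕ) : ZMod modulus) = n :=
  ZMod.natCast_mod n modulus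

theorem cast_powMod (x fuel n : ℕ) : (powMod x fuel n : ZMod modulus) = (x : ZMod modulus) ^ n := by
  induction fuel generalizing n with
  | zero => rw [powMod, cast_mod_modulus, Nat.cast_pow]
  | succ fuel ih =>
    rw [powMod, cast_mod_modulus, Nat.cast_mul, Nat.cast_pow, Nat.cast_pow, ih, ← pow_mul,
      ← pow_add, Nat.div_add_mod']

theorem powMod_ne_one {x fuel n : ℕ} (h : powMod x fuel n % modulus ≠ 1) :
    (x : ZMod modulus) ^ n ≠ 1 := by
  rw [← cast_powMod x fuel, ← Nat.cast_one, Ne, ZMod.natCast_eq_natCast_iff']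
  exact h

theorem generator_pow : ((23 : ℕ) : ZMod modulus) ^ (modulus - 1) = 1 := by
  -- Since `modulus < 2 ^ 45`, 45 halvings bring the exponent to 0, so no large power is ever
  -- formed.
  rw [← cast_powMod 23 45, show powMod 23 45 (modulus - 1) = 1 by decide +kernel, Nat.cast_one]

theorem generator_pow_ne_one {q : ℕ} (hq : q.Prime) (hd : q ∣ modulus - 1) :
    ((23 : ℕ) : ZMod modulus) ^ ((modulus - 1) / q) ≠ 1 := by
  have h : q ∈ [2, 3, 5, 7, 11, 13, 17, 19, 31] := by
    have hd' : q ∣ ([2, 2, 2, 2, 2, 3, 3, 3, 3, 3, 3, 5, 7, 11, 13, 17, 17, 19, 31] : List ℕ).prod :=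
      hd
    have hm := mem_list_primes_of_dvd_prod hq.prime (by
      simp only [List.forall_mem_cons, ← Nat.prime_iff]
      norm_num) hd'
    simpa using hm
  refine powMod_ne_one (fuel := 45) ?_
  have : ∀ q ∈ [2, 3, 5, 7, 11, 13, 17, 19, 31],
      powMod 23 45 ((modulus - 1) / q) % modulus ≠ 1 := by
    decide +kernel
  exact this q h

theorem prime_modulus : modulus.Prime :=
  lucas_primality _ _ generator_pow fun _ hq hd => generator_pow_ne_one hq hd

instance : Fact modulus.Prime := ⟨prime_modulus⟩

theorem isPrimitiveRoot_generator :
    IsPrimitiveRoot ((23 : ℕ) : ZMod modulus) (modulus - 1) := by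
  rw [← orderOf_eq_of_pow_and_pow_div_prime (by decide) generator_pow
    fun _ hq hd => generator_pow_ne_one hq hd]
  exact IsPrimitiveRoot.orderOf _

/-- A primitive root of unity of order `12 * commonLevel`. -/
def rootMod : ZMod modulus := ((23 : ℕ) : ZMod modulus) ^ 1377

theorem isPrimitiveRoot_rootMod : IsPrimitiveRoot rootMod (commonLevel * 12) :=
  isPrimitiveRoot_generator.pow (by decide) (by decide)

/-- A representative of a primitive `N`-th root of unity modulo `modulus`. -/
def levelRoot (N : ℕ) : ℕ := powMod 23 45 ((modulus - 1) / N)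

theorem cast_levelRoot {N : ℕ} (hN : N ∣ commonLevel) :
    (levelRoot N : ZMod modulus) = (rootMod ^ 12) ^ (commonLevel / N) := by
  rw [levelRoot, cast_powMod, rootMod, ← pow_mul, ← pow_mul,
    show modulus - 1 = 1377 * 12 * commonLevel by decide, Nat.mul_div_assoc _ hN, mul_assoc]

/-- The residue of an integer. -/
def intMod (c : ℤ) : ℕ := (c % modulus).toNat

theorem cast_intMod (c : ℤ) : (intMod c : ZMod modulus) = c := by
  have h : ((intMod c : ℕ) : ℤ) = c % modulus :=
    Int.toNat_of_nonneg (Int.emod_nonneg _ (by decide))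
  rw [← Int.cast_natCast, h, ZMod.intCast_mod]

/-- The residue of the value of a sparse polynomial. -/
def evalMod (l : List (ℤ × ℕ)) (x : ℕ) : ℕ :=
  l.foldr (fun t a => intMod t.1 * x ^ t.2 + a) 0 % modulus

theorem cast_evalMod (l : List (ℤ × ℕ)) (x : ℕ) :
    (evalMod l x : ZMod modulus) = evalTerms l (x : ZMod modulus) := by
  rw [evalMod, cast_mod_modulus]
  induction l with
  | nil => simp
  | cons t l ih => simp [ih, cast_intMod]

/-! ### Norm test for quadratic equations modulo the prime -/

/-- Coefficients `(u, v)` with `x ^ n = u + v * x` whenever `x ^ 2 = s * x + m`. -/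
def quadPow (s m : ℕ) : ℕ → ℕ → ℕ × ℕ
  | 0, _ => (1, 0)
  | fuel + 1, n =>
    match quadPow s m fuel (n / 2) with
    | (u, v) =>
      match n % 2 with
      | 0 => ((u ^ 2 + m * v ^ 2) % modulus, (2 * u * v + s * v ^ 2) % modulus)
      | _ => (m * (2 * u * v + s * v ^ 2) % modulus,
          (u ^ 2 + m * v ^ 2 + s * (2 * u * v + s * v ^ 2)) % modulus)

theorem cast_quadPow {s m : ℕ} {x : ZMod modulus} (hx : x ^ 2 = s * x + m) {fuel n : ℕ}
    (hn : n < 2 ^ fuel) :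
    x ^ n = ((quadPow s m fuel n).1 : ZMod modulus) + (quadPow s m fuel n).2 * x := by
  induction fuel generalizing n with
  | zero =>
    obtain rfl : n = 0 := by simpa using hn
    simp [quadPow]
  | succ fuel ih =>
    have h := ih (n := n / 2) (by rw [pow_succ] at hn; omega)
    rw [quadPow]
    generalize quadPow s m fuel (n / 2) = q at h
    obtain ⟨u, v⟩ := q
    dsimp only at h ⊢
    have hx2 : x ^ (2 * (n / 2)) = (u ^ 2 + m * v ^ 2) + (2 * u * v + s * v ^ 2) * x := by
      rw [mul_comm, pow_mul, h]
      linear_combination (v : ZMod modulus) ^ 2 * hx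
    rcases Nat.mod_two_eq_zero_or_one n with h0 | h0
    · rw [h0, ← Nat.div_add_mod n 2, h0, add_zero, hx2]
      simp only [cast_mod_modulus]
      push_cast
      ring
    · rw [h0, ← Nat.div_add_mod n 2, h0, pow_succ, hx2]
      simp only [cast_mod_modulus]
      push_cast
      linear_combination (2 * u * v + s * v ^ 2 : ZMod modulus) * hx

/-- The norm of `x ^ n - a ^ n` for the generic root `x` of `x ^ 2 - s * x + t`, where
`n = 12 * commonLevel`. -/
def quadNorm (a s t : ℕ) : ℕ :=
  -- `commonLevel * 12 < 2 ^ 34`, as `cast_quadPow` requires. Factors `modulus - 1` stand for `-1`.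
  match quadPow s ((modulus - 1) * t) 34 (commonLevel * 12) with
  | (u, v) =>
    let d := (powMod a 34 (commonLevel * 12) + (modulus - 1) * u) % modulus
    -- Here `x ^ n - a ^ n = v * x - d`, and `x` has trace `s` and norm `t`, so the norm is `d² - s
    -- v d + t v²`.
    (d ^ 2 + (modulus - 1) * s * v * d + t * v ^ 2) % modulus

theorem cast_modulus_sub_one : ((modulus - 1 : ℕ) : ZMod modulus) = -1 := by
  rw [Nat.cast_sub (by decide), ZMod.natCast_self, Nat.cast_one, zero_sub]

/-- At such an `x` one has `d = v * x`, so the norm becomes `v² (x² - s x + t)`. The test needs no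
explicit root of the quadratic. -/
theorem quadNorm_eq_zero {a s t : ℕ} {x : ZMod modulus} (hx : x ^ 2 - s * x + t = 0)
    (h : x ^ (commonLevel * 12) = (a : ZMod modulus) ^ (commonLevel * 12)) :
    quadNorm a s t = 0 := by
  have hlt : quadNorm a s t < modulus := Nat.mod_lt _ (by decide)
  suffices ((quadNorm a s t : ℕ) : ZMod modulus) = 0 by
    rw [ZMod.natCast_eq_zero_iff] at this
    exact Nat.eq_zero_of_dvd_of_lt this hlt
  have hq := cast_quadPow (s := s) (m := (modulus - 1) * t) (x := x) (fuel := 34)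
    (n := commonLevel * 12) (by
      rw [Nat.cast_mul, cast_modulus_sub_one]
      linear_combination hx) (by decide)
  rw [h] at hq
  rw [quadNorm]
  generalize quadPow s ((modulus - 1) * t) 34 (commonLevel * 12) = q at hq
  obtain ⟨u, v⟩ := q
  dsimp only at hq ⊢
  rw [cast_mod_modulus]
  push_cast [cast_mod_modulus, cast_powMod, cast_modulus_sub_one, hq]
  linear_combination (v : ZMod modulus) ^ 2 * hx

theorem aeval_rootMod_eq_zero {ω : ℂ} (hω : IsPrimitiveRoot ω commonLevel) {P : ℤ[X]}
    (h : aeval ω P = 0) : aeval (rootMod ^ 12) P = 0 :=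
  aeval_eq_zero_of_isPrimitiveRoot (by decide) hω
    (isPrimitiveRoot_rootMod.pow (by decide) (mul_comm _ _)) h

theorem aeval_mem_adjoin (P : ℤ[X]) (ω : ℂ) : aeval ω P ∈ ℚ⟮ω⟯ := by
  induction P using Polynomial.induction_on' with
  | add p q hp hq => rw [map_add]; exact add_mem hp hq
  | monomial n a =>
    rw [aeval_monomial]
    exact mul_mem (intCast_mem _ _) (pow_mem (mem_adjoin_simple_self _ _) _)

/-- If `x` is a root of unity times `A(ω)` and satisfies a quadratic equation over the field
generated by `ω`, then there is a solution modulo `modulus`. -/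
theorem quadNorm_eq_zero_of_quadratic {ω ρ : ℂ} (hω : IsPrimitiveRoot ω commonLevel)
    (hρ : IsOfFinOrder ρ) {A S T : ℤ[X]} {a s t : ℕ} (ha : aeval (rootMod ^ 12) A = a)
    (hs : aeval (rootMod ^ 12) S = s) (ht : aeval (rootMod ^ 12) T = t) (hA : aeval ω A ≠ 0)
    (h : (ρ * aeval ω A) ^ 2 - aeval ω S * (ρ * aeval ω A) + aeval ω T = 0) :
    quadNorm a s t = 0 := by
  obtain ⟨ξ, hξ, hξω⟩ := exists_isPrimitiveRoot_pow_eq (E := 12) (by decide) hω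
  have hρ1 := pow_eq_one_of_quadratic (M := commonLevel) (by decide) hω hρ
    (a := aeval ω A ^ 2) (b := -(aeval ω S * aeval ω A)) (c := aeval ω T)
    (pow_mem (aeval_mem_adjoin _ _) _)
    (neg_mem (mul_mem (aeval_mem_adjoin _ _) (aeval_mem_adjoin _ _))) (aeval_mem_adjoin _ _)
    (pow_ne_zero _ hA) (by linear_combination h)
  rw [mul_comm] at hρ1
  have : NeZero (commonLevel * 12) := ⟨by decide⟩
  -- `ρ = ξ ^ r` with `r` unknown; its reduction is a `12 * commonLevel`-th root of unity, so it
  -- drops out of the final power.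
  obtain ⟨r, -, hr⟩ := hξ.eq_pow_of_pow_eq_one hρ1
  have h2 := aeval_eq_zero_of_isPrimitiveRoot (by decide) hξ isPrimitiveRoot_rootMod
    (P := (X ^ r * A.comp (X ^ 12)) ^ 2 - S.comp (X ^ 12) * (X ^ r * A.comp (X ^ 12))
      + T.comp (X ^ 12)) (by simpa [aeval_comp, hξω, hr] using h)
  simp only [map_add, map_sub, map_mul, map_pow, aeval_X, aeval_comp, ha, hs, ht] at h2
  refine quadNorm_eq_zero h2 ?_
  rw [mul_pow, ← pow_mul, mul_comm r, pow_mul, isPrimitiveRoot_rootMod.pow_eq_one, one_pow, one_mul]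

/-- If two expressions differ by a root of unity, their powers agree modulo `modulus`. -/
theorem powMod_eq_of_eq_mul {ω ρ : ℂ} (hω : IsPrimitiveRoot ω commonLevel)
    (hρ : IsOfFinOrder ρ) {A B : ℤ[X]} {a b : ℕ} (ha : aeval (rootMod ^ 12) A = a)
    (hb : aeval (rootMod ^ 12) B = b) (hA : aeval ω A ≠ 0) (h : aeval ω B = ρ * aeval ω A) :
    (a : ZMod modulus) ^ (commonLevel * 12) = (b : ZMod modulus) ^ (commonLevel * 12) := by
  have hρ1 := pow_eq_one_of_quadratic (M := commonLevel) (by decide) hω hρ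
    (a := aeval ω A) (b := -(aeval ω B)) (c := 0) (aeval_mem_adjoin _ _)
    (neg_mem (aeval_mem_adjoin _ _)) (zero_mem _) hA (by rw [h]; ring)
  have h2 := aeval_rootMod_eq_zero hω
    (P := A ^ (commonLevel * 12) - B ^ (commonLevel * 12)) (by
      rw [map_sub, map_pow, map_pow, h, mul_pow, mul_comm commonLevel, hρ1, one_mul, sub_self])
  rw [map_sub, map_pow, map_pow, ha, hb, sub_eq_zero] at h2
  exact h2

/-! ### Table data and finite checks -/

/-- The level of each row, with its value as a sparse polynomial in a root of unity of that
order. -/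
def exceptionalTerms : Fin 33 → ℕ × List (ℤ × ℕ) := ![
  (11, [(1, 0), (1, 1), (1, 2), (1, 4), (-1, 5), (1, 7)]),
  (19, [(1, 0), (1, 1), (1, 4), (1, 7), (1, 8), (1, 9), (1, 10), (1, 12), (1, 14)]),
  (20, [(1, 0), (1, 1), (1, 3), (-1, 4)]),
  (24, [(1, 0), (1, 1), (1, 5), (-1, 6)]),
  (31, [(1, 0), (1, 1), (1, 3), (1, 8), (1, 12), (1, 18)]),
  (51, [(1, 0), (1, 3), (-1, 10), (1, 15), (1, 21), (1, 24), (1, 30), (1, 33), (1, 39)]),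
  (84, [(1, 0), (-1, 4), (-1, 13), (-1, 16), (1, 19), (1, 21), (1, 22), (1, 31)]),
  (91, [(1, 0), (1, 7), (1, 14), (-1, 17), (1, 21), (1, 42), (-1, 69), (1, 70), (-1, 82)]),
  (33, [(1, 0), (1, 6), (-1, 8), (1, 21)]),
  (28, [(1, 0), (1, 1), (-1, 3), (-1, 11)]),
  (33, [(1, 0), (1, 6), (-1, 7), (-1, 10)]),
  (21, [(1, 0), (-1, 1), (-1, 5), (1, 18)]),
  (28, [(1, 0), (1, 1), (-1, 3), (1, 4)]),
  (21, [(1, 0), (-1, 1), (1, 6), (1, 18)]),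
  (60, [(1, 0), (-1, 3), (-1, 6), (-1, 8)]),
  (11, [(1, 0), (1, 1), (1, 2), (1, 5)]),
  (35, [(1, 0), (-1, 6), (1, 7), (1, 10), (1, 15), (1, 17), (1, 22)]),
  (40, [(1, 0), (-1, 3), (1, 7), (1, 10)]),
  (60, [(1, 0), (-1, 3), (-1, 5), (-1, 8)]),
  (24, [(1, 0), (1, 1), (1, 7)]),
  (13, [(1, 0), (1, 1), (1, 4)]),
  (21, [(1, 0), (-1, 1), (-1, 4), (1, 12)]),
  (7, [(1, 1), (1, 3), (1, 4), (-1, 5)]),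
  (28, [(1, 0), (1, 4), (1, 12), (1, 7), (1, 11), (1, 19)]),
  (39, [(1, 0), (-1, 2), (-1, 5), (-1, 8), (-1, 11), (-1, 20), (-1, 32)]),
  (55, [(1, 0), (-1, 1), (-1, 16), (1, 22), (-1, 26), (-1, 31), (-1, 36)]),
  (60, [(1, 0), (-1, 4), (1, 48), (1, 15), (-1, 19), (1, 3)]),
  (105, [(1, 0), (-1, 7), (1, 84), (1, 15), (-1, 22), (1, 99), (1, 45), (-1, 52), (1, 24)]),
  (21, [(1, 0), (-1, 1), (-1, 13)]),
  (11, [(1, 0), (1, 1), (1, 2), (1, 4), (1, 7)]),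
  (13, [(1, 0), (1, 1), (1, 3), (1, 9)]),
  (35, [(1, 0), (-1, 1), (1, 7), (-1, 11), (-1, 16)]),
  (7, [(1, 0), (1, 1), (1, 3)])]

/-- The coefficients, leading one omitted, of the minimal polynomial of `αᾱ - 5`, for each
row. -/
def houseCoeffs : Fin 33 → List ℤ := ![
  [0],
  [0],
  [0],
  [0],
  [0],
  [0],
  [0],
  [0],
  [1, 40, 390, 1443, 2665, 2782, 1742, 666, 152, 19],
  [1, 24, 86, 104, 53, 12],
  [1, 15, 35, 28, 9],
  [1, 16, 60, 78, 44, 11],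
  [1, 6, 5],
  [1, 5],
  [1, 4],
  [11, 55, 77, 44, 11],
  [1, 3],
  [1, 3],
  [1, 3],
  [2, 4],
  [3, 5],
  [7, 14, 7],
  [1],
  [1],
  [1],
  [1],
  [1],
  [1],
  [13, 19, 8],
  [2],
  [2],
  [2],
  [3]]

/-- The level of a row. -/
abbrev rowLevel (i : Fin 33) : ℕ := (exceptionalTerms i).1

/-- The sparse polynomial of a row. -/
abbrev rowTerms (i : Fin 33) : List (ℤ × ℕ) := (exceptionalTerms i).2

/-- The residue of the value of a row. -/
def rowMod (i : Fin 33) : ℕ := evalMod (rowTerms i) (levelRoot (rowLevel i))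

/-- The residue of `αᾱ` for a row. -/
def rowNormMod (i : Fin 33) : ℕ :=
  rowMod i * evalMod (rowTerms i) (powMod (levelRoot (rowLevel i)) 7 (rowLevel i - 1)) % modulus

/-- The residue of `2 * a + b * (3 - t)`, where `a = y + y⁻¹`, `b = y ^ 2 + y⁻²` for the
primitive fifth root of unity `y = levelRoot 5 ^ k`. -/
def formThreeTrace (k t : ℕ) : ℕ :=
  (2 * (levelRoot 5 ^ k + levelRoot 5 ^ (4 * k))
    + (levelRoot 5 ^ (2 * k) + levelRoot 5 ^ (3 * k)) * (3 + (modulus - 1) * t)) % modulus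

/-- The residue of the power of the value of a row that is invariant under multiplication by
roots of unity. -/
def rowInvariant (i : Fin 33) : ℕ := powMod (rowMod i) 34 (commonLevel * 12)

/-- The invariant of the `k`-th conjugate of a row. -/
def conjInvariant (i : Fin 33) (k : ℕ) : ℕ :=
  powMod (evalMod (rowTerms i) (powMod (levelRoot (rowLevel i)) 7 k)) 34 (commonLevel * 12)

theorem rowMod_ne_zero (i : Fin 33) : rowMod i ≠ 0 := by
  revert i
  decide +kernel

/-- For `x = 1 + η`, trace and norm agree: `x + x̄ = 2 + η + η⁻¹ = x x̄`. -/
theorem quadNorm_form_one (i : Fin 33) :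
    quadNorm (rowMod i) (rowNormMod i) (rowNormMod i) ≠ 0 := by
  revert i
  decide +kernel

/-- The trace of `x = 1 + η - η⁻¹` is `2`, because `η - η⁻¹` is purely imaginary. -/
theorem quadNorm_form_two (i : Fin 33) : quadNorm (rowMod i) 2 (rowNormMod i) ≠ 0 := by
  revert i
  decide +kernel

/-- The reduction of `ω` is fixed, so `ζ₅` may reduce to any of the four primitive fifth roots of
unity; each gets its own check. -/
theorem quadNorm_form_three (i : Fin 33) (k : ℕ) (hk : k < 5) (hk0 : k ≠ 0) :
    quadNorm (rowMod i) (formThreeTrace k (rowNormMod i)) (rowNormMod i) ≠ 0 := by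
  revert i k
  decide +kernel

/-- Conjugating one side only is enough: the root of unity for row `j` is fixed by the choice of
`ω`, while that for row `i` is then an arbitrary primitive power. -/
theorem invariants_ne (i : Fin 33) (k : ℕ) (hk : k < rowLevel i) (hc : k.Coprime (rowLevel i))
     (j : Fin 33) (h : conjInvariant i k = rowInvariant j) : i = j := by
  revert i k j
  decide +kernel

/-! ### Exact arithmetic modulo `X ^ N - 1` -/

section dense

variable {R : Type*} [CommRing R]

/-- The value at `x` of the polynomial with the given list of coefficients. -/
def evalDense (v : List ℤ) (x : R) : R :=
  v.foldr (fun (a : ℤ) (r : R) => a + x * r) 0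

@[simp] theorem evalDense_nil (x : R) : evalDense [] x = 0 := rfl

@[simp] theorem evalDense_cons (a : ℤ) (v : List ℤ) (x : R) :
    evalDense (a :: v) x = a + x * evalDense v x := rfl

/-- Sum of lists of coefficients. -/
def addDense : List ℤ → List ℤ → List ℤ
  | [], w => w
  | v, [] => v
  | a :: v, b :: w => (a + b) :: addDense v w

theorem evalDense_addDense (v w : List ℤ) (x : R) :
    evalDense (addDense v w) x = evalDense v x + evalDense w x := by
  induction v generalizing w with
  | nil => simp [addDense]
  | cons a v ih =>
    cases w with
    | nil => simp [addDense]
    | cons b w => simp only [addDense, evalDense_cons, ih]; push_cast; ring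

theorem evalDense_append (v w : List ℤ) (x : R) :
    evalDense (v ++ w) x = evalDense v x + x ^ v.length * evalDense w x := by
  induction v with
  | nil => simp
  | cons a v ih => simp only [List.cons_append, evalDense_cons, ih, List.length_cons]; ring

theorem evalDense_replicate_zero (n : ℕ) (x : R) : evalDense (List.replicate n 0) x = 0 := by
  induction n with
  | zero => simp
  | succ n ih => simp [List.replicate_succ, ih]

theorem evalDense_map_mul (c : ℤ) (v : List ℤ) (x : R) :
    evalDense (v.map (c * ·)) x = c * evalDense v x := by
  induction v with
  | nil => simp
  | cons a v ih => simp only [List.map_cons, evalDense_cons, ih]; push_cast; ring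

/-- Reduction of exponents modulo `N`, for lists of length at most `2 * N`. -/
def foldDense (N : ℕ) (v : List ℤ) : List ℤ := addDense (v.take N) (v.drop N)

theorem evalDense_foldDense {N : ℕ} {x : R} (hx : x ^ N = 1) (v : List ℤ) :
    evalDense (foldDense N v) x = evalDense v x := by
  rw [foldDense, evalDense_addDense]
  conv_rhs => rw [← List.take_append_drop N v, evalDense_append]
  rcases le_total N v.length with h | h
  · rw [List.length_take, min_eq_left h, hx, one_mul]
  · rw [List.drop_eq_nil_of_le h]
    simp

/-- Product of a sparse polynomial and a dense one, with exponents modulo `N`. -/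
def mulDense (N : ℕ) (l : List (ℤ × ℕ)) (v : List ℤ) : List ℤ :=
  foldDense N
    (l.foldr (fun t r => addDense ((List.replicate t.2 0 ++ v).map (t.1 * ·)) r) [])

theorem evalDense_mulDense {N : ℕ} {x : R} (hx : x ^ N = 1) (l : List (ℤ × ℕ)) (v : List ℤ) :
    evalDense (mulDense N l v) x = evalTerms l x * evalDense v x := by
  rw [mulDense, evalDense_foldDense hx]
  induction l with
  | nil => simp
  | cons t l ih =>
    rw [List.foldr_cons, evalDense_addDense, ih, evalDense_map_mul, evalDense_append,
      evalDense_replicate_zero, List.length_replicate, evalTerms_cons]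
    ring

/-- The monic polynomial with lower coefficients `c`, evaluated at a sparse polynomial. -/
def hornerDense (N : ℕ) (l : List (ℤ × ℕ)) (c : List ℤ) : List ℤ :=
  c.foldr (fun a r => addDense [a] (mulDense N l r)) [1]

theorem evalDense_hornerDense {N : ℕ} {x : R} (hx : x ^ N = 1) (l : List (ℤ × ℕ)) (c : List ℤ) :
    evalDense (hornerDense N l c) x =
      c.foldr (fun (a : ℤ) (r : R) => a + evalTerms l x * r) 1 := by
  induction c with
  | nil => simp [hornerDense]
  | cons a c ih =>
    rw [hornerDense, List.foldr_cons, evalDense_addDense, evalDense_mulDense hx, List.foldr_cons,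
      ← ih]
    simp [hornerDense]

/-- Product with `X ^ (N / q) - 1` for all `q` in a list, which vanishes at all `N`-th roots of
unity that are not primitive. -/
def killImprimitive (N : ℕ) (qs : List ℕ) (v : List ℤ) : List ℤ :=
  qs.foldr (fun q r => mulDense N [(1, N / q), (-1, 0)] r) v

/-- The factors `x ^ (N / q) - 1` are nonzero at a primitive root and can be cancelled. Multiplying
by them turns vanishing at primitive roots into vanishing of every coefficient modulo `X ^ N - 1`,
which avoids division by a cyclotomic polynomial. -/
theorem evalDense_eq_zero_of_killImprimitive [IsDomain R] {N : ℕ} {x : R}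
    (hx : IsPrimitiveRoot x N) {qs : List ℕ} (hqs : ∀ q ∈ qs, 0 < N / q ∧ N / q < N) {v : List ℤ}
    (h : ∀ a ∈ killImprimitive N qs v, a = 0) : evalDense v x = 0 := by
  have h0 : evalDense (killImprimitive N qs v) x = 0 := by
    rw [List.eq_replicate_of_mem h, evalDense_replicate_zero]
  clear h
  induction qs with
  | nil => exact h0
  | cons q qs ih =>
    rw [List.forall_mem_cons] at hqs
    refine ih hqs.2 ?_
    rw [killImprimitive, List.foldr_cons, evalDense_mulDense hx.pow_eq_one] at h0
    refine (mul_eq_zero.1 h0).resolve_left fun h1 => ?_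
    refine hx.pow_ne_one_of_pos_of_lt hqs.1.1.ne' hqs.1.2 ?_
    simpa [add_neg_eq_zero] using h1

end dense

/-! ### The bound for the house -/

/-- The sparse polynomial of `αᾱ - 5`. -/
def normSubFive (N : ℕ) (l : List (ℤ × ℕ)) : List (ℤ × ℕ) :=
  -- Complex conjugation inverts `ζ`, and `N - 1` represents `-1` modulo `N`.
  (-5, 0) :: l.flatMap fun s => l.map fun t => (s.1 * t.1, (s.2 + t.2 * (N - 1)) % N)

theorem evalTerms_append {R : Type*} [CommRing R] (l m : List (ℤ × ℕ)) (x : R) :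
    evalTerms (l ++ m) x = evalTerms l x + evalTerms m x := by
  simp [evalTerms]

theorem evalTerms_normSubFive {N : ℕ} (hN : 0 < N) {ζ : ℂ} (hζ : ζ ^ N = 1)
    (l : List (ℤ × ℕ)) :
    evalTerms (normSubFive N l) ζ = evalTerms l ζ * evalTerms l ζ⁻¹ - 5 := by
  have hinv : ζ⁻¹ = ζ ^ (N - 1) :=
    inv_eq_of_mul_eq_one_right (by rw [← pow_succ', Nat.sub_add_cancel hN, hζ])
  have hrow : ∀ (s : ℤ × ℕ) (m : List (ℤ × ℕ)),
      evalTerms (m.map fun t => (s.1 * t.1, (s.2 + t.2 * (N - 1)) % N)) ζ =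
        s.1 * ζ ^ s.2 * evalTerms m ζ⁻¹ := by
    intro s m
    induction m with
    | nil => simp
    | cons t m ih =>
      rw [List.map_cons, evalTerms_cons, ih, evalTerms_cons, ← pow_eq_pow_mod _ hζ, hinv]
      push_cast
      ring
  have hall : ∀ k m : List (ℤ × ℕ),
      evalTerms (k.flatMap fun s => m.map fun t => (s.1 * t.1, (s.2 + t.2 * (N - 1)) % N)) ζ =
        evalTerms k ζ * evalTerms m ζ⁻¹ := by
    intro k m
    induction k with
    | nil => simp
    | cons s k ih =>
      rw [List.flatMap_cons, evalTerms_append, hrow, ih, evalTerms_cons]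
      ring
  rw [normSubFive, evalTerms_cons, hall]
  push_cast
  ring

theorem evalTerms_mul_inv {ζ : ℂ} (hζ : ‖ζ‖ = 1) (l : List (ℤ × ℕ)) :
    evalTerms l ζ * evalTerms l ζ⁻¹ = ((‖evalTerms l ζ‖ ^ 2 : ℝ) : ℂ) := by
  rw [← conj_evalTerms l hζ, Complex.mul_conj, Complex.normSq_eq_norm_sq]

theorem foldr_horner_pos {c : List ℤ} (hc : ∀ a ∈ c, 0 ≤ a) {u : ℝ} (hu : 0 < u) :
    0 < c.foldr (fun (a : ℤ) (r : ℝ) => a + u * r) 1 := by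
  induction c with
  | nil => simp
  | cons a c ih =>
    rw [List.forall_mem_cons] at hc
    have := ih hc.2
    have : (0 : ℝ) ≤ a := by exact_mod_cast hc.1
    rw [List.foldr_cons]
    positivity

theorem ofReal_foldr_horner (c : List ℤ) (u : ℝ) :
    ((c.foldr (fun (a : ℤ) (r : ℝ) => a + u * r) 1 : ℝ) : ℂ) =
      c.foldr (fun (a : ℤ) (r : ℂ) => a + u * r) 1 := by
  induction c with
  | nil => simp
  | cons a c ih => simp [← ih]

/-- The real number `|α|² - 5` is a root of a monic polynomial with nonnegative coefficients, so it
cannot be positive. The relation holds at every primitive `N`-th root, so all conjugates are covered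
at once. -/
theorem norm_sq_le_five {N : ℕ} (hN : 0 < N) {l : List (ℤ × ℕ)} {c : List ℤ} {qs : List ℕ}
    (hc : ∀ a ∈ c, 0 ≤ a) (hqs : ∀ q ∈ qs, 0 < N / q ∧ N / q < N)
    (h : ∀ a ∈ killImprimitive N qs (hornerDense N (normSubFive N l) c), a = 0)
    {ζ : ℂ} (hζ : IsPrimitiveRoot ζ N) : ‖evalTerms l ζ‖ ^ 2 ≤ 5 := by
  have h1 := evalDense_eq_zero_of_killImprimitive hζ hqs h
  rw [evalDense_hornerDense hζ.pow_eq_one, evalTerms_normSubFive hN hζ.pow_eq_one,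
    evalTerms_mul_inv (hζ.norm'_eq_one hN.ne')] at h1
  have h2 := ofReal_foldr_horner c (‖evalTerms l ζ‖ ^ 2 - 5)
  rw [Complex.ofReal_sub, Complex.ofReal_ofNat, h1, Complex.ofReal_eq_zero] at h2
  by_contra! hlt
  exact (foldr_horner_pos hc (sub_pos.2 hlt)).ne' h2

/-- The prime divisors of a level. -/
def levelPrimes (N : ℕ) : List ℕ := [2, 3, 5, 7, 11, 13, 17, 19, 31].filter (· ∣ N)

theorem houseCoeffs_nonneg (i : Fin 33) : ∀ a ∈ houseCoeffs i, 0 ≤ a := by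
  revert i
  decide +kernel

theorem levelPrimes_spec (i : Fin 33) : ∀ q ∈ levelPrimes (rowLevel i),
    0 < rowLevel i / q ∧ rowLevel i / q < rowLevel i := by
  revert i
  decide +kernel

theorem killImprimitive_hornerDense (i : Fin 33) :
    ∀ a ∈ killImprimitive (rowLevel i) (levelPrimes (rowLevel i))
      (hornerDense (rowLevel i) (normSubFive (rowLevel i) (rowTerms i)) (houseCoeffs i)),
      a = 0 := by
  revert i
  decide +kernel

/-! ### Rows as polynomials in a common root of unity -/

theorem powMod_lt (x fuel n : ℕ) : powMod x fuel n < modulus := by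
  cases fuel <;> exact Nat.mod_lt _ (by decide)

theorem isPrimitiveRoot_zeta {n : ℕ} (hn : n ≠ 0) : IsPrimitiveRoot (zeta n) n :=
  Complex.isPrimitiveRoot_exp n hn

theorem zeta_mul_pow {n m : ℕ} (hm : m ≠ 0) : zeta (n * m) ^ m = zeta n := by
  rw [zeta, zeta, ← Complex.exp_nat_mul]
  congr 1
  have : (m : ℂ) ≠ 0 := Nat.cast_ne_zero.2 hm
  push_cast
  field_simp

theorem zeta_four : zeta 4 = Complex.I := by
  refine Eq.trans ?_ Complex.exp_pi_div_two_mul_I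
  rw [zeta]
  congr 1
  push_cast
  ring

theorem rowLevel_eq (i : Fin 33) : rowLevel i = (exceptionalTable i).level := by
  fin_cases i <;> rfl

theorem rowLevel_pos (i : Fin 33) : 0 < rowLevel i := by
  revert i
  decide

theorem rowLevel_dvd (i : Fin 33) : rowLevel i ∣ commonLevel := by
  revert i
  decide +kernel

/-- The three product rows are built from fixed `zeta` values and ignore `ζ`, so `ζ'` cannot always
be `ζ` itself. -/
theorem exists_value_eq_evalTerms (i : Fin 33) {ζ : ℂ}
    (hζ : IsPrimitiveRoot ζ (exceptionalTable i).level) :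
    ∃ ζ' : ℂ, IsPrimitiveRoot ζ' (rowLevel i) ∧
      (exceptionalTable i).value ζ = evalTerms (rowTerms i) ζ' := by
  have h7 : zeta 7 = zeta 28 ^ 4 := (zeta_mul_pow (n := 7) (m := 4) (by decide)).symm
  have hI : Complex.I = zeta 28 ^ 7 := by
    rw [← zeta_four, ← zeta_mul_pow (n := 4) (m := 7) (by decide)]
  have h15 : zeta 15 = zeta 60 ^ 4 := (zeta_mul_pow (n := 15) (m := 4) (by decide)).symm
  have hI' : Complex.I = zeta 60 ^ 15 := by
    rw [← zeta_four, ← zeta_mul_pow (n := 4) (m := 15) (by decide)]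
  have h15' : zeta 15 = zeta 105 ^ 7 := (zeta_mul_pow (n := 15) (m := 7) (by decide)).symm
  have h7' : zeta 7 = zeta 105 ^ 15 := (zeta_mul_pow (n := 7) (m := 15) (by decide)).symm
  have h60 : zeta 60 ^ 60 = 1 := (isPrimitiveRoot_zeta (by decide)).pow_eq_one
  by_cases h24 : i = 23
  · subst h24
    refine ⟨zeta 28, isPrimitiveRoot_zeta (by decide), ?_⟩
    change (1 + Complex.I) * (1 + zeta 7 + zeta 7 ^ 3) = evalTerms
      [(1, 0), (1, 4), (1, 12), (1, 7), (1, 11), (1, 19)] (zeta 28)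
    rw [hI, h7]
    simp
    ring
  by_cases h27 : i = 26
  · subst h27
    refine ⟨zeta 60, isPrimitiveRoot_zeta (by decide), ?_⟩
    change (1 + Complex.I) * (1 - zeta 15 + zeta 15 ^ 12) = evalTerms
      [(1, 0), (-1, 4), (1, 48), (1, 15), (-1, 19), (1, 3)] (zeta 60)
    rw [hI', h15]
    simp
    -- The product exponent `15 + 48 = 63` was reduced to `3`.
    linear_combination zeta 60 ^ 3 * h60
  by_cases h28 : i = 27
  · subst h28
    have h105 : zeta 105 ^ 105 = 1 := (isPrimitiveRoot_zeta (by decide)).pow_eq_one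
    refine ⟨zeta 105, isPrimitiveRoot_zeta (by decide), ?_⟩
    change (1 + zeta 7 + zeta 7 ^ 3) * (1 - zeta 15 + zeta 15 ^ 12) = evalTerms
      [(1, 0), (-1, 7), (1, 84), (1, 15), (-1, 22), (1, 99), (1, 45), (-1, 52), (1, 24)] (zeta 105)
    rw [h7', h15']
    simp
    -- The product exponent `45 + 84 = 129` was reduced to `24`.
    linear_combination zeta 105 ^ 24 * h105
  · refine ⟨ζ, rowLevel_eq i ▸ hζ, ?_⟩
    fin_cases i <;>
      first
      | exact absurd rfl h24
      | exact absurd rfl h27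
      | exact absurd rfl h28
      | (simp [exceptionalTable, rowTerms, exceptionalTerms]; try ring)

/-- The value of a row as a polynomial in a root of unity of order `commonLevel`. -/
noncomputable def rowPolynomial (i : Fin 33) (k : ℕ) : ℤ[X] :=
  evalTerms (rowTerms i) (X ^ (commonLevel / rowLevel i * k))

theorem aeval_rowPolynomial {R : Type*} [CommRing R] (i : Fin 33) (k : ℕ) (x : R) :
    aeval x (rowPolynomial i k) =
      evalTerms (rowTerms i) ((x ^ (commonLevel / rowLevel i)) ^ k) := by
  rw [rowPolynomial]
  exact (map_evalTerms (aeval x : ℤ[X] →ₐ[ℤ] R).toRingHom _ _).trans (by simp [pow_mul])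

theorem aeval_rootMod_rowPolynomial (i : Fin 33) (k : ℕ) :
    aeval (rootMod ^ 12) (rowPolynomial i k) =
      (evalMod (rowTerms i) (powMod (levelRoot (rowLevel i)) 7 k) : ZMod modulus) := by
  rw [aeval_rowPolynomial, cast_evalMod, cast_powMod, cast_levelRoot (rowLevel_dvd i)]

theorem aeval_rootMod_rowPolynomial_one (i : Fin 33) :
    aeval (rootMod ^ 12) (rowPolynomial i 1) = (rowMod i : ZMod modulus) := by
  rw [aeval_rowPolynomial, rowMod, cast_evalMod, cast_levelRoot (rowLevel_dvd i), pow_one]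

theorem exists_common_root {i : Fin 33} {ζ : ℂ} (hζ : IsPrimitiveRoot ζ (rowLevel i)) :
    ∃ ω : ℂ, IsPrimitiveRoot ω commonLevel ∧ ω ^ (commonLevel / rowLevel i) = ζ := by
  have h := Nat.mul_div_cancel' (rowLevel_dvd i)
  obtain ⟨ω, hω, h1⟩ := exists_isPrimitiveRoot_pow_eq
    (N := rowLevel i) (E := commonLevel / rowLevel i) (by rw [h]; decide) hζ
  exact ⟨ω, h ▸ hω, h1⟩

theorem evalTerms_rowTerms_ne_zero {i : Fin 33} {ζ : ℂ} (hζ : IsPrimitiveRoot ζ (rowLevel i)) :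
    evalTerms (rowTerms i) ζ ≠ 0 := by
  intro h0
  obtain ⟨ω, hω, h1⟩ := exists_common_root hζ
  have h2 := aeval_rootMod_eq_zero hω (P := rowPolynomial i 1)
    (by rw [aeval_rowPolynomial, h1, pow_one, h0])
  rw [aeval_rootMod_rowPolynomial_one, ZMod.natCast_eq_zero_iff] at h2
  exact rowMod_ne_zero i (Nat.eq_zero_of_dvd_of_lt h2 (Nat.mod_lt _ (by decide)))

theorem isOfFinOrder_inv {ρ : ℂ} (hρ : IsOfFinOrder ρ) : IsOfFinOrder ρ⁻¹ := by
  obtain ⟨n, hn, h⟩ := isOfFinOrder_iff_pow_eq_one.1 hρ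
  exact isOfFinOrder_iff_pow_eq_one.2 ⟨n, hn, by rw [inv_pow, h, inv_one]⟩

theorem ne_zero_of_isOfFinOrder {ρ : ℂ} (hρ : IsOfFinOrder ρ) : ρ ≠ 0 :=
  norm_ne_zero_iff.1 (by rw [hρ.norm_eq_one]; exact one_ne_zero)

theorem conj_of_isOfFinOrder {ρ : ℂ} (hρ : IsOfFinOrder ρ) : starRingEnd ℂ ρ = ρ⁻¹ :=
  (Complex.inv_eq_conj hρ.norm_eq_one).symm

/-- The square of the absolute value of a row, as a polynomial in a root of unity. -/
noncomputable def rowNormPolynomial (i : Fin 33) : ℤ[X] :=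
  rowPolynomial i 1 * rowPolynomial i (rowLevel i - 1)

theorem aeval_rootMod_rowNormPolynomial (i : Fin 33) :
    aeval (rootMod ^ 12) (rowNormPolynomial i) = (rowNormMod i : ZMod modulus) := by
  rw [rowNormPolynomial, map_mul, aeval_rootMod_rowPolynomial_one, aeval_rootMod_rowPolynomial,
    rowNormMod, cast_mod_modulus, Nat.cast_mul]

theorem aeval_rowNormPolynomial {i : Fin 33} {ω : ℂ} (hω : IsPrimitiveRoot ω commonLevel) :
    aeval ω (rowNormPolynomial i) =
      evalTerms (rowTerms i) (ω ^ (commonLevel / rowLevel i)) *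
        starRingEnd ℂ (evalTerms (rowTerms i) (ω ^ (commonLevel / rowLevel i))) := by
  have h1 : (ω ^ (commonLevel / rowLevel i)) ^ rowLevel i = 1 := by
    rw [← pow_mul, Nat.div_mul_cancel (rowLevel_dvd i), hω.pow_eq_one]
  have hn : ‖ω ^ (commonLevel / rowLevel i)‖ = 1 :=
    Complex.norm_eq_one_of_pow_eq_one h1 (rowLevel_pos i).ne'
  rw [conj_evalTerms _ hn, rowNormPolynomial, map_mul, aeval_rowPolynomial, aeval_rowPolynomial,
    pow_one, inv_eq_of_mul_eq_one_right
      (by rw [← pow_succ', Nat.sub_add_cancel (rowLevel_pos i), h1])]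

theorem mul_conj_of_eq_mul {ρ α x : ℂ} (hρ : IsOfFinOrder ρ) (hx : x = ρ * α) :
    x * starRingEnd ℂ x = α * starRingEnd ℂ α := by
  have h0 : ρ ≠ 0 := ne_zero_of_isOfFinOrder hρ
  rw [hx, map_mul, conj_of_isOfFinOrder hρ]
  field_simp

/-- A multiple `x` of a row by a root of unity is a root of `X ^ 2 - (x + x̄) * X + αᾱ`; if
`x + x̄` is a polynomial in `ω`, this has a solution modulo `modulus`. -/
theorem quadNorm_eq_zero_of_eq_mul {i : Fin 33} {ω ρ x : ℂ} (hω : IsPrimitiveRoot ω commonLevel)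
    (hρ : IsOfFinOrder ρ)
    (hx : x = ρ * evalTerms (rowTerms i) (ω ^ (commonLevel / rowLevel i))) {S : ℤ[X]} {s : ℕ}
    (hs : aeval (rootMod ^ 12) S = (s : ZMod modulus))
    (hS : aeval ω S = x + starRingEnd ℂ x) : quadNorm (rowMod i) s (rowNormMod i) = 0 := by
  have hp := hω.pow (by decide) (Nat.div_mul_cancel (rowLevel_dvd i)).symm
  have hA : aeval ω (rowPolynomial i 1) =
      evalTerms (rowTerms i) (ω ^ (commonLevel / rowLevel i)) := by
    rw [aeval_rowPolynomial, pow_one]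
  refine quadNorm_eq_zero_of_quadratic hω hρ (aeval_rootMod_rowPolynomial_one i) hs
    (aeval_rootMod_rowNormPolynomial i) (hA ▸ evalTerms_rowTerms_ne_zero hp) ?_
  rw [hA, ← hx, hS, aeval_rowNormPolynomial hω, ← mul_conj_of_eq_mul hρ hx]
  ring

/-! ### Exclusion of the three forms -/

/-- This makes a single root of unity a sum of two, so the first form needs only one case. It
follows from `(z + 1)(z² - z + 1) = z³ + 1 = 0` at `z = ζ₆`. -/
theorem zeta_six_add_inv : zeta 6 + (zeta 6)⁻¹ = 1 := by
  have h6 := isPrimitiveRoot_zeta (n := 6) (by decide)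
  have h36 : zeta 6 ^ 3 = -1 := by
    rw [show zeta 6 ^ 3 = zeta 2 from zeta_mul_pow (n := 2) (m := 3) (by decide)]
    exact (isPrimitiveRoot_zeta (by decide)).eq_neg_one_of_two_right
  have h0 := h6.ne_zero (by decide)
  have hne : zeta 6 + 1 ≠ 0 := fun h => by
    have h1 : zeta 6 = -1 := eq_neg_of_add_eq_zero_left h
    exact h6.pow_ne_one_of_pos_of_lt (l := 2) (by decide) (by decide) (by rw [h1]; ring)
  field_simp
  apply mul_left_cancel₀ hne
  linear_combination h36

/-- A nonzero number of the first form is a sum of exactly two roots of unity. -/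
theorem IsFormOne.exists_add_eq {α : ℂ} (h : IsFormOne α) (h0 : α ≠ 0) :
    ∃ u v : ℂ, IsOfFinOrder u ∧ IsOfFinOrder v ∧ u + v = α := by
  obtain ⟨s, hs, hfin, hsum⟩ := h
  have hcases : s.card = 0 ∨ s.card = 1 ∨ s.card = 2 := by omega
  rcases hcases with h | h | h
  · obtain rfl := Multiset.card_eq_zero.1 h
    exact absurd hsum.symm h0
  · obtain ⟨u, rfl⟩ := Multiset.card_eq_one.1 h
    have hu : IsOfFinOrder u := hfin u (by simp)
    have hf : IsOfFinOrder (zeta 6) :=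
      (isPrimitiveRoot_zeta (n := 6) (by decide)).isOfFinOrder (by decide)
    refine ⟨u * zeta 6, u * (zeta 6)⁻¹, hu.mul hf, hu.mul (isOfFinOrder_inv hf), ?_⟩
    rw [← mul_add, zeta_six_add_inv, mul_one, ← hsum, Multiset.sum_singleton]
  · obtain ⟨u, v, rfl⟩ := Multiset.card_eq_two.1 h
    exact ⟨u, v, hfin u (by simp), hfin v (by simp), by simpa using hsum⟩

theorem not_isFormOne_evalTerms {i : Fin 33} {ζ : ℂ} (hζ : IsPrimitiveRoot ζ (rowLevel i)) :
    ¬ IsFormOne (evalTerms (rowTerms i) ζ) := by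
  intro h
  obtain ⟨u, v, hu, hv, huv⟩ := h.exists_add_eq (evalTerms_rowTerms_ne_zero hζ)
  obtain ⟨ω, hω, rfl⟩ := exists_common_root hζ
  have hu0 : u ≠ 0 := ne_zero_of_isOfFinOrder hu
  have hv0 : v ≠ 0 := ne_zero_of_isOfFinOrder hv
  -- Dividing by `u` normalizes the sum to `1 + η` with `η = v * u⁻¹`.
  have hx : 1 + v * u⁻¹ =
      u⁻¹ * evalTerms (rowTerms i) (ω ^ (commonLevel / rowLevel i)) := by
    rw [← huv]
    field_simp
  refine quadNorm_form_one i (quadNorm_eq_zero_of_eq_mul hω (isOfFinOrder_inv hu) hx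
    (aeval_rootMod_rowNormPolynomial i) ?_)
  rw [aeval_rowNormPolynomial hω, ← mul_conj_of_eq_mul (isOfFinOrder_inv hu) hx, map_add, map_one, map_mul,
    map_inv₀, conj_of_isOfFinOrder hu, conj_of_isOfFinOrder hv]
  field_simp
  ring

theorem not_isFormTwo_evalTerms {i : Fin 33} {ζ : ℂ} (hζ : IsPrimitiveRoot ζ (rowLevel i)) :
    ¬ IsFormTwo (evalTerms (rowTerms i) ζ) := by
  rintro ⟨η, hη, ρ, β, hρ, hβ, hx⟩
  obtain ⟨ζ', hζ', rfl⟩ := exists_isPrimitiveRoot_of_isConjRoot (rowLevel_pos i) hζ _ hβ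
  obtain ⟨ω, hω, rfl⟩ := exists_common_root hζ'
  refine quadNorm_form_two i (quadNorm_eq_zero_of_eq_mul hω hρ hx (S := 2)
    (by rw [map_ofNat, Nat.cast_ofNat]) ?_)
  rw [map_ofNat, map_sub, map_add, map_one, map_inv₀, conj_of_isOfFinOrder hη, inv_inv]
  ring

theorem not_isFormThree_evalTerms {i : Fin 33} {ζ : ℂ} (hζ : IsPrimitiveRoot ζ (rowLevel i)) :
    ¬ IsFormThree (evalTerms (rowTerms i) ζ) := by
  rintro ⟨η, hη, ρ, β, hρ, hβ, hx⟩
  obtain ⟨ζ', hζ', rfl⟩ := exists_isPrimitiveRoot_of_isConjRoot (rowLevel_pos i) hζ _ hβ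
  obtain ⟨ω, hω, rfl⟩ := exists_common_root hζ'
  have h5 := isPrimitiveRoot_zeta (n := 5) (by decide)
  have hy : IsPrimitiveRoot (ω ^ (commonLevel / 5)) 5 := hω.pow (by decide) (by decide)
  obtain ⟨k, hk, hk5⟩ := hy.eq_pow_of_pow_eq_one h5.pow_eq_one
  have hk0 : k ≠ 0 := by
    rintro rfl
    exact h5.ne_one (by decide) (by rw [← hk5, pow_zero])
  have hη0 : η ≠ 0 := ne_zero_of_isOfFinOrder hη
  have hz5 : zeta 5 ^ 5 = 1 := h5.pow_eq_one
  have hzc : starRingEnd ℂ (zeta 5) = zeta 5 ^ 4 := by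
    rw [conj_of_isOfFinOrder (h5.isOfFinOrder (by decide))]
    exact inv_eq_of_mul_eq_one_right (by rw [← pow_succ', hz5])
  have hsum : 1 + zeta 5 + zeta 5 ^ 2 + zeta 5 ^ 3 + zeta 5 ^ 4 = 0 := by
    simpa [Finset.sum_range_succ] using h5.geom_sum_eq_zero (by decide)
  set z := zeta 5
  have hxc : starRingEnd ℂ (z + z ^ 4 + (z ^ 2 + z ^ 3) * η) =
      z + z ^ 4 + (z ^ 2 + z ^ 3) * η⁻¹ := by
    simp only [map_add, map_mul, map_pow, hzc, conj_of_isOfFinOrder hη]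
    linear_combination (z ^ 11 + z ^ 6 + z + (z ^ 7 + z ^ 2 + z ^ 3) * η⁻¹) * hz5
  -- With `a = z + z⁴` and `b = z² + z³`, both real, `a + b = ab = -1`, so `|a + bη|² = a² + b² +
  -- ab(η + η⁻¹) = 3 - (η + η⁻¹)`. This expresses the trace `2a + b(η + η⁻¹)` through the norm.
  have hnorm : aeval ω (rowNormPolynomial i) = 3 - (η + η⁻¹) := by
    rw [aeval_rowNormPolynomial hω, ← mul_conj_of_eq_mul hρ hx, hxc]
    have h1 : z + z ^ 4 = -1 - (z ^ 2 + z ^ 3) := by linear_combination hsum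
    have h2 : (z ^ 2 + z ^ 3) ^ 2 = 1 - (z ^ 2 + z ^ 3) := by
      linear_combination (z + 2) * hz5 + hsum
    have h3 : η * η⁻¹ = 1 := mul_inv_cancel₀ hη0
    rw [h1]
    linear_combination (2 - η - η⁻¹) * h2 + (z ^ 2 + z ^ 3) ^ 2 * h3
  refine quadNorm_form_three i k hk hk0 (quadNorm_eq_zero_of_eq_mul hω hρ hx
    (S := 2 * (X ^ (commonLevel / 5 * k) + X ^ (commonLevel / 5 * (4 * k)))
      + (X ^ (commonLevel / 5 * (2 * k)) + X ^ (commonLevel / 5 * (3 * k)))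
        * (3 - rowNormPolynomial i)) ?_ ?_)
  · simp only [map_add, map_mul, map_sub, map_pow, aeval_X, map_ofNat,
      aeval_rootMod_rowNormPolynomial, pow_mul (rootMod ^ 12) (commonLevel / 5)]
    rw [formThreeTrace, cast_mod_modulus, ← cast_levelRoot (by decide)]
    push_cast [cast_modulus_sub_one]
    ring
  · rw [hxc]
    simp only [map_add, map_mul, map_sub, map_pow, aeval_X, map_ofNat, hnorm,
      pow_mul ω (commonLevel / 5)]
    rw [mul_comm 4, mul_comm 2 k,
      mul_comm 3 k, pow_mul _ k, pow_mul _ k, pow_mul _ k, hk5]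
    ring

/-! ### House bound and inequivalence for the rows -/

theorem house_evalTerms_sq_le {i : Fin 33} {ζ : ℂ} (hζ : IsPrimitiveRoot ζ (rowLevel i)) :
    house (evalTerms (rowTerms i) ζ) ^ 2 ≤ 5 := by
  obtain ⟨β, hβ, hh⟩ := (isGreatest_house (isAlgebraic_evalTerms (rowLevel_pos i) hζ _)).1
  obtain ⟨ζ', hζ', rfl⟩ := exists_isPrimitiveRoot_of_isConjRoot (rowLevel_pos i) hζ _ hβ
  rw [hh]
  exact norm_sq_le_five (rowLevel_pos i) (houseCoeffs_nonneg i) (levelPrimes_spec i)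
    (killImprimitive_hornerDense i) hζ'

theorem eq_of_equivalent_evalTerms {i j : Fin 33} {ζ ξ : ℂ}
    (hζ : IsPrimitiveRoot ζ (rowLevel i)) (hξ : IsPrimitiveRoot ξ (rowLevel j))
    (h : Equivalent (evalTerms (rowTerms i) ζ) (evalTerms (rowTerms j) ξ)) : i = j := by
  obtain ⟨ρ, β, hρ, hβ, hx⟩ := h
  obtain ⟨ζ', hζ', rfl⟩ := exists_isPrimitiveRoot_of_isConjRoot (rowLevel_pos i) hζ _ hβ
  -- `ω` is chosen above the root of row `j`; the conjugate of row `i` is then given by some power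
  -- `k` coprime to its level.
  obtain ⟨ω, hω, rfl⟩ := exists_common_root hξ
  have hp : IsPrimitiveRoot (ω ^ (commonLevel / rowLevel i)) (rowLevel i) :=
    hω.pow (by decide) (Nat.div_mul_cancel (rowLevel_dvd i)).symm
  have : NeZero (rowLevel i) := ⟨(rowLevel_pos i).ne'⟩
  obtain ⟨k, hk, hc, rfl⟩ := hp.isPrimitiveRoot_iff.1 hζ'
  refine invariants_ne i k hk hc j ?_
  have hA : aeval ω (rowPolynomial i k) =
      evalTerms (rowTerms i) ((ω ^ (commonLevel / rowLevel i)) ^ k) := aeval_rowPolynomial i k ω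
  have hB : aeval ω (rowPolynomial j 1) =
      evalTerms (rowTerms j) (ω ^ (commonLevel / rowLevel j)) := by
    rw [aeval_rowPolynomial, pow_one]
  have hpow := powMod_eq_of_eq_mul hω hρ (aeval_rootMod_rowPolynomial i k)
    (aeval_rootMod_rowPolynomial_one j) (hA ▸ evalTerms_rowTerms_ne_zero hζ') (by rw [hA, hB, hx])
  rw [← cast_powMod _ 34, ← cast_powMod _ 34, ZMod.natCast_eq_natCast_iff', Nat.mod_eq_of_lt
    (powMod_lt _ _ _), Nat.mod_eq_of_lt (powMod_lt _ _ _)] at hpow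
  exact hpow

end CyclotomicHouse

theorem corollary3p8
    (ζ : Fin 33 → ℂ)
    (hζ : ∀ i, IsPrimitiveRoot (ζ i) (CyclotomicHouse.exceptionalTable i).level) :
    (∀ i : Fin 33,
      (CyclotomicHouse.exceptionalTable i).value (ζ i) ∈ CyclotomicHouse.cyclotomicIntegers ∧
      CyclotomicHouse.house ((CyclotomicHouse.exceptionalTable i).value (ζ i)) ^ 2 ≤ 5 ∧
      ¬ CyclotomicHouse.IsFormOne ((CyclotomicHouse.exceptionalTable i).value (ζ i)) ∧
      ¬ CyclotomicHouse.IsFormTwo ((CyclotomicHouse.exceptionalTable i).value (ζ i)) ∧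
      ¬ CyclotomicHouse.IsFormThree ((CyclotomicHouse.exceptionalTable i).value (ζ i))) ∧
    (∀ i j : Fin 33, i ≠ j →
      ¬ CyclotomicHouse.Equivalent ((CyclotomicHouse.exceptionalTable i).value (ζ i))
        ((CyclotomicHouse.exceptionalTable j).value (ζ j))) := by
  choose ξ hξ hval using fun i => CyclotomicHouse.exists_value_eq_evalTerms i (hζ i)
  refine ⟨fun i => ?_, fun i j hij => ?_⟩
  · rw [hval]
    exact ⟨CyclotomicHouse.evalTerms_mem_cyclotomicIntegers _
        ((hξ i).isOfFinOrder (CyclotomicHouse.rowLevel_pos i).ne'),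
      CyclotomicHouse.house_evalTerms_sq_le (hξ i),
      CyclotomicHouse.not_isFormOne_evalTerms (hξ i),
      CyclotomicHouse.not_isFormTwo_evalTerms (hξ i),
      CyclotomicHouse.not_isFormThree_evalTerms (hξ i)⟩
  · rw [hval, hval]
    exact fun h => hij (CyclotomicHouse.eq_of_equivalent_evalTerms (hξ i) (hξ j) h)
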